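/- For complex $a,q$ with $|q|<1$ write $(a;q)_n=\prod_{i=0}^{n-1}(1-aq^i)$, $(a;q)_\infty=\prod_{i=0}^{\infty}(1-aq^i)$ and $(a_1,\dots,a_k;q)_\infty=(a_1;q)_\infty\cdots(a_k;q)_\infty$. Let $q,z\in\mathbb{C}$ with $|q|<1$ and $z\neq 0$, and suppose that $zq^{2k}\neq 1$ and $z^{-1}q^{2k}\neq 1$ for every integer $k\ge 1$. Let $$K(z;q)=\sum_{n=0}^{\infty}\frac{(-1)^n(q;q^2)_n\,q^{n^2}}{(zq^2;q^2)_n(z^{-1}q^2;q^2)_n}$$ be the universal mock theta function $K$. Then the infinite products and the series below and the series defining $K(z;q)$ converge, and $$(zq^2,z^{-1}q^2,q^2;q^2)_\infty\,K(z;q)=\sum_{n=0}^{\infty}\Bigl(\sum_{m=0}^{n}(-1)^n z^{m-n}q^{\frac12(2n^2-m^2)+\frac12(2n-m)}+\sum_{m=1}^{n}(-1)^n z^{n-m+1}q^{\frac12(2n^2-m^2)+\frac12(2n+m)}\Bigr).$$ All exponents of $q$ on the right-hand side are non-negative integers. -/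

import Mathlib

/-- The finite `q`-shifted factorial `(a; q)_n = ∏_{i=0}^{n-1} (1 - a q^i)`. -/
def qPochhammer (a q : ℂ) (n : ℕ) : ℂ :=
  ∏ i ∈ Finset.range n, (1 - a * q ^ i)

/-- The infinite `q`-shifted factorial `(a; q)_∞ = ∏_{i=0}^∞ (1 - a q^i)`, for `|q| < 1`. -/
noncomputable def qPochhammerInf (a q : ℂ) : ℂ :=
  ∏' i : ℕ, (1 - a * q ^ i)

/-- The `n`-th term of the series defining `K(z; q)`:
`(-1)^n (q; q^2)_n q^{n^2} / ((z q^2; q^2)_n (z^{-1} q^2; q^2)_n)`. -/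
noncomputable def mockKTerm (z q : ℂ) (n : ℕ) : ℂ :=
  (-1) ^ n * qPochhammer q (q ^ 2) n * q ^ (n ^ 2) /
    (qPochhammer (z * q ^ 2) (q ^ 2) n * qPochhammer (z⁻¹ * q ^ 2) (q ^ 2) n)

/-- The universal mock theta function `K(z; q)`. -/
noncomputable def mockK (z q : ℂ) : ℂ :=
  ∑' n : ℕ, mockKTerm z q n

/-- The `n`-th term of the Hecke-Rogers double sum. Both integer exponents of `q` are halves of
even integers, so the integer divisions by `2` are exact. -/
noncomputable def heckeRogersTerm (z q : ℂ) (n : ℕ) : ℂ :=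
  (∑ m ∈ Finset.Icc 0 n, (-1) ^ n * z ^ ((m : ℤ) - (n : ℤ)) *
      q ^ (((2 * (n : ℤ) ^ 2 - (m : ℤ) ^ 2) + (2 * (n : ℤ) - (m : ℤ))) / 2)) +
    ∑ m ∈ Finset.Icc 1 n, (-1) ^ n * z ^ ((n : ℤ) - (m : ℤ) + 1) *
      q ^ (((2 * (n : ℤ) ^ 2 - (m : ℤ) ^ 2) + (2 * (n : ℤ) + (m : ℤ))) / 2)

open Filter Topology

/-! Put `p = q ^ 2`. The theta product absorbs the denominators of the `n`-th term of `K`, leaving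
`(z p^{n+1}; p)_∞ (z⁻¹ p^{n+1}; p)_∞ (p; p)_∞` times its numerator. Euler's expansion of the first
two factors gives coefficients of `z ^ j` with `1 / (p; p)_{k+J}`, where `J = |j|`. This combines
with `(p; p)_∞` into `(p^{k+J+1}; p)_∞`, which Euler expands in a third index `l`. On `n + k + l =
M` the dependence on `J` is a common factor (`expansionTerm_eq_mul`). The sum over `k + l` is a
finite `q`-binomial sum, and the remaining sum over `n` is `sum_qBaileyTerm`. So the product is `∑
z^j (-1)^{J+M} q^{J²+J+2JM+M(M+1)/2}` over `j ∈ ℤ`, `M ≥ 0`; grouping by `N = J + M` gives the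
Hecke-Rogers sum. Absolute convergence justifies every rearrangement. -/

theorem qPochhammer_succ (a q : ℂ) (n : ℕ) :
    qPochhammer a q (n + 1) = qPochhammer a q n * (1 - a * q ^ n) :=
  Finset.prod_range_succ _ _

@[simp] theorem qPochhammer_zero (a q : ℂ) : qPochhammer a q 0 = 1 :=
  Finset.prod_range_zero _

theorem qPochhammer_add (a q : ℂ) (m n : ℕ) :
    qPochhammer a q (m + n) = qPochhammer a q m * qPochhammer (a * q ^ m) q n := by
  simp only [qPochhammer, Finset.prod_range_add, pow_add, mul_assoc]

theorem one_sub_pow_succ_ne_zero {p : ℂ} (hp : ‖p‖ < 1) (k : ℕ) : 1 - p ^ (k + 1) ≠ 0 := by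
  intro h
  have h1 : ‖p‖ ^ (k + 1) = 1 := by rw [← norm_pow, ← sub_eq_zero.mp h, norm_one]
  exact absurd h1 (pow_lt_one₀ (norm_nonneg _) hp (by omega)).ne

theorem qPochhammer_self_ne_zero {p : ℂ} (hp : ‖p‖ < 1) (n : ℕ) : qPochhammer p p n ≠ 0 := by
  refine Finset.prod_ne_zero_iff.mpr fun i _ => ?_
  rw [← pow_succ']
  exact one_sub_pow_succ_ne_zero hp i

/-! ### Euler coefficients and the finite `q`-binomial theorem. -/

/-- The coefficients of Euler's expansion of `(x; p)_∞` in powers of `x`. -/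
noncomputable def eulerCoeff (p : ℂ) (k : ℕ) : ℂ :=
  (-1) ^ k * p ^ k.choose 2 / qPochhammer p p k

@[simp] theorem eulerCoeff_zero (p : ℂ) : eulerCoeff p 0 = 1 := by simp [eulerCoeff]

theorem choose_succ_two (k : ℕ) : (k + 1).choose 2 = k.choose 2 + k := by
  rw [Nat.choose_succ_succ' k 1, Nat.choose_one_right, add_comm]

theorem eulerCoeff_succ (p : ℂ) (k : ℕ) :
    eulerCoeff p (k + 1) = -p ^ k / (1 - p ^ (k + 1)) * eulerCoeff p k := by
  rw [eulerCoeff, eulerCoeff, qPochhammer_succ, ← pow_succ', choose_succ_two, div_mul_div_comm]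
  congr 1 <;> ring

theorem eulerCoeff_succ_mul {p : ℂ} (hp : ‖p‖ < 1) (k : ℕ) :
    eulerCoeff p (k + 1) * (1 - p ^ (k + 1)) = -p ^ k * eulerCoeff p k := by
  have := one_sub_pow_succ_ne_zero hp k
  rw [eulerCoeff_succ]
  field_simp

/-- The finite `q`-binomial theorem. -/
theorem sum_eulerCoeff_antidiagonal {p : ℂ} (hp : ‖p‖ < 1) (x : ℂ) (s : ℕ) :
    ∑ c ∈ Finset.HasAntidiagonal.antidiagonal s, eulerCoeff p c.1 * x ^ c.1 / qPochhammer p p c.2 =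
      qPochhammer x p s / qPochhammer p p s := by
  induction s with
  | zero => simp
  | succ s ih =>
    have hs := one_sub_pow_succ_ne_zero hp s
    have hP := qPochhammer_self_ne_zero hp
    have key : (∑ c ∈ Finset.HasAntidiagonal.antidiagonal (s + 1),
        eulerCoeff p c.1 * x ^ c.1 / qPochhammer p p c.2) * (1 - p ^ (s + 1)) =
        (∑ c ∈ Finset.HasAntidiagonal.antidiagonal s, eulerCoeff p c.1 * x ^ c.1 / qPochhammer p p c.2) *
          (1 - x * p ^ s) := by
      -- Write `1 - p^{a+b} = (1 - p^a) p^b + (1 - p^b)`: each piece vanishes at one end of the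
      -- antidiagonal and shifts it down to level `s`.
      have split : ∀ c ∈ Finset.HasAntidiagonal.antidiagonal (s + 1),
          eulerCoeff p c.1 * x ^ c.1 / qPochhammer p p c.2 * (1 - p ^ (s + 1)) =
          eulerCoeff p c.1 * (1 - p ^ c.1) * p ^ c.2 * x ^ c.1 / qPochhammer p p c.2 +
          eulerCoeff p c.1 * x ^ c.1 * ((1 - p ^ c.2) / qPochhammer p p c.2) := by
        intro c hc
        rw [← Finset.HasAntidiagonal.mem_antidiagonal.mp hc, pow_add]
        ring
      rw [Finset.sum_mul, Finset.sum_congr rfl split, Finset.sum_add_distrib,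
        Finset.Nat.sum_antidiagonal_succ, Finset.Nat.sum_antidiagonal_succ']
      simp only [pow_zero, sub_self, mul_zero, zero_mul, zero_div, zero_add]
      rw [← Finset.sum_add_distrib, Finset.sum_mul]
      refine Finset.sum_congr rfl fun c hc => ?_
      have h2 := one_sub_pow_succ_ne_zero hp c.2
      rw [eulerCoeff_succ_mul hp, qPochhammer_succ, ← pow_succ', ← Finset.HasAntidiagonal.mem_antidiagonal.mp hc]
      have := hP c.2
      field_simp
      ring
    rw [ih] at key
    rw [qPochhammer_succ, qPochhammer_succ, ← pow_succ', eq_div_iff (mul_ne_zero (hP s) hs),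
      mul_comm (qPochhammer p p s), ← mul_assoc, key]
    have := hP s
    field_simp

/-! ### The terminating `q`-Bailey sum. -/

/-- The summand of the terminating `q`-Bailey sum `sum_qBaileyTerm`. -/
noncomputable def qBaileyTerm (q : ℂ) (M n : ℕ) : ℂ :=
  if n ≤ M then qPochhammer q (q ^ 2) n * q ^ (n ^ 2 + (M - n) ^ 2 + (M - n)) *
    qPochhammer (q ^ 2) (q ^ 2) (M + n) /
      (qPochhammer (q ^ 2) (q ^ 2) (2 * n) * qPochhammer (q ^ 2) (q ^ 2) (M - n)) else 0

theorem qBaileyTerm_add (q : ℂ) (n s : ℕ) :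
    qBaileyTerm q (n + s) n = qPochhammer q (q ^ 2) n * q ^ (n ^ 2 + s ^ 2 + s) *
    qPochhammer (q ^ 2) (q ^ 2) (2 * n + s) /
      (qPochhammer (q ^ 2) (q ^ 2) (2 * n) * qPochhammer (q ^ 2) (q ^ 2) s) := by
  rw [qBaileyTerm, if_pos (by omega), Nat.add_sub_cancel_left]
  congr 3
  omega

theorem qBaileyTerm_of_lt (q : ℂ) {M n : ℕ} (h : M < n) : qBaileyTerm q M n = 0 :=
  if_neg (by omega)

theorem norm_sq_lt_one {q : ℂ} (hq : ‖q‖ < 1) : ‖q ^ 2‖ < 1 := by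
  rw [norm_pow]; exact pow_lt_one₀ (norm_nonneg _) hq two_ne_zero

theorem qBaileyTerm_zero {q : ℂ} (hq : ‖q‖ < 1) (M : ℕ) :
    qBaileyTerm q M 0 = q ^ (M ^ 2 + M) := by
  have := qPochhammer_self_ne_zero (norm_sq_lt_one hq) M
  simpa [this] using qBaileyTerm_add q 0 M

/-- A creative-telescoping certificate: the right side is a multiple, independent of `n`, of the
forward difference of `q^{2n+1} * qBaileyTerm q (M + 1) n`. The boundary cases, where some terms
vanish, are checked separately. -/
theorem qBaileyTerm_recurrence {q : ℂ} (hq : ‖q‖ < 1) (M n : ℕ) :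
    qBaileyTerm q (M + 2) (n + 1) - q ^ (2 * M + 3) * qBaileyTerm q M (n + 1) =
      -(1 - q ^ (2 * M + 3)) * (q ^ (2 * n + 3) * qBaileyTerm q (M + 1) (n + 1) -
        q ^ (2 * n + 1) * qBaileyTerm q (M + 1) n) := by
  have hp := norm_sq_lt_one hq
  have hP := qPochhammer_self_ne_zero hp
  have h1 := fun k => one_sub_pow_succ_ne_zero hp k
  rcases lt_trichotomy n M with h | rfl | h
  · obtain ⟨s, rfl⟩ : ∃ s, M = n + 1 + s := ⟨M - (n + 1), by omega⟩
    rw [show n + 1 + s + 2 = n + 1 + (s + 2) by ring, qBaileyTerm_add, qBaileyTerm_add,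
      show n + 1 + s + 1 = n + (s + 2) by ring, qBaileyTerm_add,
      show n + (s + 2) = n + 1 + (s + 1) by ring, qBaileyTerm_add,
      show 2 * (n + 1) + (s + 2) = 2 * n + s + 2 + 1 + 1 by ring,
      show 2 * (n + 1) + (s + 1) = 2 * n + s + 2 + 1 by ring,
      show 2 * n + (s + 2) = 2 * n + s + 2 by ring,
      show 2 * (n + 1) + s = 2 * n + s + 2 by ring,
      show 2 * (n + 1) = 2 * n + 1 + 1 by ring]
    simp only [qPochhammer_succ, ← pow_succ']
    have a1 := h1 (2 * n)
    have a2 := h1 (2 * n + 1)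
    have a3 := h1 s
    have a4 := h1 (s + 1)
    have a5 := hP (2 * n)
    have a6 := hP s
    field_simp
    ring
  · rw [qBaileyTerm_of_lt q (Nat.lt_succ_self n), show n + 2 = n + 1 + 1 by ring,
      qBaileyTerm_add, qBaileyTerm_add q n 1, ← Nat.add_zero (n + 1), qBaileyTerm_add,
      show 2 * (n + 1) + 1 = 2 * n + 1 + 1 + 1 by ring,
      show 2 * (n + 1) = 2 * n + 1 + 1 by ring]
    simp only [qPochhammer_succ, ← pow_succ', Nat.add_zero, qPochhammer_zero]
    have a1 := h1 (2 * n)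
    have a2 := h1 (2 * n + 1)
    have a3 := h1 0
    have a5 := hP (2 * n)
    field_simp
    ring
  · rcases Nat.lt_or_ge (M + 1) n with h' | h'
    · simp [qBaileyTerm_of_lt q (show M + 2 < n + 1 by omega),
        qBaileyTerm_of_lt q (show M < n + 1 by omega),
        qBaileyTerm_of_lt q (show M + 1 < n + 1 by omega), qBaileyTerm_of_lt q h']
    · obtain rfl : n = M + 1 := by omega
      rw [qBaileyTerm_of_lt q (show M < M + 1 + 1 by omega),
        qBaileyTerm_of_lt q (show M + 1 < M + 1 + 1 by omega),
        show M + 2 = M + 1 + 1 + 0 by ring, Nat.add_zero (M + 1 + 1), ← Nat.add_zero (M + 1 + 1),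
        qBaileyTerm_add, ← Nat.add_zero (M + 1), qBaileyTerm_add]
      simp only [Nat.add_zero, qPochhammer_zero, qPochhammer_succ q]
      have := hP (2 * (M + 1))
      have := hP (2 * (M + 1 + 1))
      field_simp
      ring

/-- Summing the recurrence leaves only the lower end of the telescoping sum, which cancels against
the separate `n = 0` terms. -/
theorem sum_qBaileyTerm_add_two {q : ℂ} (hq : ‖q‖ < 1) (M : ℕ) :
    ∑ n ∈ Finset.range (M + 3), qBaileyTerm q (M + 2) n =
      q ^ (2 * M + 3) * ∑ n ∈ Finset.range (M + 1), qBaileyTerm q M n := by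
  have e : ∑ n ∈ Finset.range (M + 1), qBaileyTerm q M n =
      ∑ n ∈ Finset.range (M + 3), qBaileyTerm q M n := by
    rw [Finset.sum_range_succ _ (M + 2), Finset.sum_range_succ _ (M + 1),
      qBaileyTerm_of_lt q (Nat.lt_succ_self M), qBaileyTerm_of_lt q (show M < M + 2 by omega)]
    ring
  have tel := Finset.sum_range_sub (fun n => q ^ (2 * n + 1) * qBaileyTerm q (M + 1) n) (M + 2)
  rw [e, ← sub_eq_zero, Finset.mul_sum, ← Finset.sum_sub_distrib, Finset.sum_range_succ',
    Finset.sum_congr rfl fun n _ => qBaileyTerm_recurrence hq M n, ← Finset.mul_sum]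
  simp only [show ∀ n, 2 * (n + 1) + 1 = 2 * n + 3 by intro n; ring] at tel
  rw [tel, qBaileyTerm_of_lt q (show M + 1 < M + 2 by omega), qBaileyTerm_zero hq,
    qBaileyTerm_zero hq, qBaileyTerm_zero hq]
  ring

/-- A terminating case of the `q`-analogue of Bailey's `₂F₁(1/2)` sum. -/
theorem sum_qBaileyTerm {q : ℂ} (hq : ‖q‖ < 1) (M : ℕ) :
    ∑ n ∈ Finset.range (M + 1), qBaileyTerm q M n = q ^ (M + 1).choose 2 := by
  induction M using Nat.twoStepInduction with
  | zero => simp [qBaileyTerm_zero hq]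
  | one =>
    have := qPochhammer_self_ne_zero (norm_sq_lt_one hq) 2
    rw [Finset.sum_range_succ, Finset.sum_range_one, qBaileyTerm_zero hq,
      ← Nat.add_zero 1, qBaileyTerm_add]
    simp only [Nat.add_zero, mul_one, qPochhammer_zero, mul_div_cancel_right₀ _ this]
    simp [qPochhammer_succ]
    ring
  | more M ih _ =>
    rw [sum_qBaileyTerm_add_two hq, ih, ← pow_add, choose_succ_two (M + 2),
      choose_succ_two (M + 1)]
    congr 1
    omega

/-! ### Coefficients of the expansion in powers of `z`. -/

/-- The summand of the expansion, in powers of `z`, of the product of `K(z; q)` with the theta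
product; `J` is the absolute value of the exponent of `z`. -/
noncomputable def expansionTerm (q : ℂ) (J n k l : ℕ) : ℂ :=
  (-1) ^ n * qPochhammer q (q ^ 2) n * q ^ n ^ 2 * (q ^ 2) ^ ((n + 1) * (2 * k + J)) *
    eulerCoeff (q ^ 2) k * ((-1) ^ (k + J) * (q ^ 2) ^ (k + J).choose 2) *
      (eulerCoeff (q ^ 2) l * (q ^ 2) ^ ((k + J + 1) * l))

theorem add_choose_two (k J : ℕ) : (k + J).choose 2 = k.choose 2 + k * J + J.choose 2 := by
  induction J with
  | zero => simp
  | succ J ih => rw [← Nat.add_assoc, choose_succ_two, choose_succ_two, ih]; ring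

theorem expansionTerm_eq_mul (q : ℂ) (J n k l : ℕ) :
    expansionTerm q J n k l =
      (-1) ^ J * (q ^ 2) ^ (J.choose 2 + J + J * (n + (k + l))) * expansionTerm q 0 n k l := by
  simp only [expansionTerm, add_choose_two, Nat.add_zero, pow_add]
  ring

/-- Since `C(k,2) + C(l,2) + kl = C(s,2)` for `k + l = s`, what remains is the `q`-binomial sum at
`x = p^{2n+1}`, `p = q ^ 2`. -/
theorem sum_expansionTerm_inner {q : ℂ} (hq : ‖q‖ < 1) (n s : ℕ) :
    ∑ c ∈ Finset.HasAntidiagonal.antidiagonal s, expansionTerm q 0 n c.1 c.2 =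
      (-1) ^ (n + s) * qBaileyTerm q (n + s) n := by
  have hp := norm_sq_lt_one hq
  have hP := qPochhammer_self_ne_zero hp
  have h : ∀ c ∈ Finset.HasAntidiagonal.antidiagonal s, expansionTerm q 0 n c.1 c.2 =
      (-1) ^ (n + s) * qPochhammer q (q ^ 2) n * q ^ n ^ 2 * (q ^ 2) ^ (s.choose 2 + s) *
        (eulerCoeff (q ^ 2) c.1 * (q ^ 2 * (q ^ 2) ^ (2 * n)) ^ c.1 /
          qPochhammer (q ^ 2) (q ^ 2) c.2) := by
    intro c hc
    rw [← Finset.HasAntidiagonal.mem_antidiagonal.mp hc, expansionTerm, add_choose_two c.1 c.2]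
    nth_rw 2 [eulerCoeff]
    simp only [Nat.add_zero, pow_add, mul_pow, ← pow_mul]
    ring
  rw [Finset.sum_congr rfl h, ← Finset.mul_sum, sum_eulerCoeff_antidiagonal hp, qBaileyTerm_add,
    qPochhammer_add]
  have h2 : (q ^ 2) ^ (s.choose 2 + s) = q ^ (s ^ 2 + s) := by
    rw [← pow_mul, ← choose_succ_two]
    congr 1
    rw [Nat.choose_two_right, Nat.mul_div_cancel' (Nat.even_mul_pred_self _).two_dvd,
      Nat.add_sub_cancel]
    ring
  rw [h2]
  have := hP (2 * n)
  have := hP s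
  field_simp
  ring

theorem sum_expansionTerm_zero {q : ℂ} (hq : ‖q‖ < 1) (M : ℕ) :
    ∑ d ∈ Finset.HasAntidiagonal.antidiagonal M, ∑ c ∈ Finset.HasAntidiagonal.antidiagonal d.2,
      expansionTerm q 0 d.1 c.1 c.2 = (-1) ^ M * q ^ (M + 1).choose 2 := by
  rw [← sum_qBaileyTerm hq, Finset.mul_sum,
    Finset.Nat.sum_antidiagonal_eq_sum_range_succ (fun n s =>
      ∑ c ∈ Finset.HasAntidiagonal.antidiagonal s, expansionTerm q 0 n c.1 c.2)]
  refine Finset.sum_congr rfl fun n hn => ?_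
  rw [sum_expansionTerm_inner hq, Nat.add_sub_cancel' (Nat.lt_succ_iff.mp (Finset.mem_range.mp hn))]

theorem sum_expansionTerm {q : ℂ} (hq : ‖q‖ < 1) (J M : ℕ) :
    ∑ d ∈ Finset.HasAntidiagonal.antidiagonal M, ∑ c ∈ Finset.HasAntidiagonal.antidiagonal d.2,
      expansionTerm q J d.1 c.1 c.2 =
      (-1) ^ (J + M) * q ^ (J ^ 2 + J + 2 * J * M + (M + 1).choose 2) := by
  have h : ∀ d ∈ Finset.HasAntidiagonal.antidiagonal M,
      ∑ c ∈ Finset.HasAntidiagonal.antidiagonal d.2, expansionTerm q J d.1 c.1 c.2 =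
      (-1) ^ J * (q ^ 2) ^ (J.choose 2 + J + J * M) *
      ∑ c ∈ Finset.HasAntidiagonal.antidiagonal d.2, expansionTerm q 0 d.1 c.1 c.2 := by
    intro d hd
    rw [Finset.mul_sum]
    refine Finset.sum_congr rfl fun c hc => ?_
    rw [expansionTerm_eq_mul, Finset.HasAntidiagonal.mem_antidiagonal.mp hc,
      Finset.HasAntidiagonal.mem_antidiagonal.mp hd]
  have e : 2 * (J.choose 2 + J + J * M) = J ^ 2 + J + 2 * J * M := by
    rw [← choose_succ_two, mul_add, Nat.choose_two_right,
      Nat.mul_div_cancel' (Nat.even_mul_pred_self _).two_dvd, Nat.add_sub_cancel]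
    ring
  rw [Finset.sum_congr rfl h, ← Finset.mul_sum, sum_expansionTerm_zero hq, ← pow_mul, e, pow_add,
    pow_add]
  ring

/-! ### Infinite products and Euler's expansion. -/

theorem summable_norm_of_ratio {f r : ℕ → ℂ} (h : ∀ n, f (n + 1) = r n * f n)
    (hr : Tendsto r atTop (𝓝 0)) : Summable fun n => ‖f n‖ := by
  refine summable_of_ratio_norm_eventually_le (r := 1 / 2) (by norm_num) ?_
  have := (tendsto_norm_zero.comp hr).eventually (ge_mem_nhds (show (0 : ℝ) < 1 / 2 by norm_num))
  filter_upwards [this] with n hn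
  rw [h, norm_norm, norm_norm, norm_mul]
  exact mul_le_mul_of_nonneg_right hn (norm_nonneg _)

theorem summable_norm_eulerCoeff_mul_pow {p : ℂ} (hp : ‖p‖ < 1) (x : ℂ) :
    Summable fun k => ‖eulerCoeff p k * x ^ k‖ := by
  refine summable_norm_of_ratio (r := fun k => -p ^ k / (1 - p ^ (k + 1)) * x) (fun k => ?_) ?_
  · rw [eulerCoeff_succ, pow_succ]; ring
  · have h := tendsto_pow_atTop_nhds_zero_of_norm_lt_one hp
    have h1 := (tendsto_add_atTop_iff_nat 1).mpr h
    simpa using (h.neg.div (h1.const_sub 1) (by simp)).mul_const x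

theorem multipliable_one_sub_mul_pow {p : ℂ} (hp : ‖p‖ < 1) (a : ℂ) :
    Multipliable fun i : ℕ => 1 - a * p ^ i := by
  simp only [sub_eq_add_neg]
  refine multipliable_one_add_of_summable ?_
  simpa using (summable_geometric_of_norm_lt_one hp).norm.mul_left ‖a‖

theorem qPochhammerInf_eq_mul {p : ℂ} (hp : ‖p‖ < 1) (a : ℂ) (n : ℕ) :
    qPochhammerInf a p = qPochhammer a p n * qPochhammerInf (a * p ^ n) p := by
  have h : (fun i : ℕ => 1 - a * p ^ (i + n)) = fun i => 1 - a * p ^ n * p ^ i := by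
    funext i; ring
  have := Multipliable.prod_mul_tprod_nat_mul' (f := fun i => 1 - a * p ^ i) (k := n)
    (h ▸ multipliable_one_sub_mul_pow hp (a * p ^ n))
  rw [qPochhammerInf, ← this, qPochhammer, qPochhammerInf, h]

/-- Euler's expansion of `(x; p)_∞`. -/
theorem hasSum_eulerCoeff {p : ℂ} (hp : ‖p‖ < 1) (x : ℂ) :
    HasSum (fun k => eulerCoeff p k * x ^ k) (qPochhammerInf x p) := by
  set e : ℂ → ℂ := fun x => ∑' k, eulerCoeff p k * x ^ k with he
  have hs := fun x => (summable_norm_eulerCoeff_mul_pow hp x).of_norm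
  -- This functional equation determines the series: iterate it and use `e (x * p ^ N) → e 0 = 1`.
  have step : ∀ x, e x = (1 - x) * e (x * p) := by
    intro x
    have h1 := (hs x).sub (hs (x * p))
    have key : e x - e (x * p) = -x * e (x * p) := by
      simp only [he]
      rw [← (hs x).tsum_sub (hs (x * p)), h1.tsum_eq_zero_add, ← tsum_mul_left]
      simp only [pow_zero, sub_self, zero_add]
      refine tsum_congr fun k => ?_
      rw [mul_pow, show eulerCoeff p (k + 1) * x ^ (k + 1) -
        eulerCoeff p (k + 1) * (x ^ (k + 1) * p ^ (k + 1)) =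
        eulerCoeff p (k + 1) * (1 - p ^ (k + 1)) * x ^ (k + 1) by ring, eulerCoeff_succ_mul hp]
      ring
    linear_combination key
  have iter : ∀ N, e x = qPochhammer x p N * e (x * p ^ N) := by
    intro N
    induction N with
    | zero => simp
    | succ N ih => rw [ih, step, qPochhammer_succ, pow_succ]; ring_nf
  have hlim : Tendsto (fun N : ℕ => e (x * p ^ N)) atTop (𝓝 1) := by
    have h0 : (1 : ℂ) = ∑' k, eulerCoeff p k * 0 ^ k := by
      rw [tsum_eq_single 0 fun k hk => by simp [hk]]; simp
    rw [h0]
    refine tendsto_tsum_of_dominated_convergence (summable_norm_eulerCoeff_mul_pow hp x)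
      (fun k => ?_) (Eventually.of_forall fun N k => ?_)
    · have h := (tendsto_pow_atTop_nhds_zero_of_norm_lt_one hp).const_mul x
      rw [mul_zero] at h
      exact (h.pow k).const_mul _
    · rw [mul_pow, ← mul_assoc, norm_mul]
      refine mul_le_of_le_one_right (norm_nonneg _) ?_
      rw [← pow_mul, norm_pow]
      exact pow_le_one₀ (norm_nonneg _) hp.le
  have hprod : Tendsto (fun N => qPochhammer x p N) atTop (𝓝 (qPochhammerInf x p)) :=
    (multipliable_one_sub_mul_pow hp x).hasProd.tendsto_prod_nat
  have hlim2 := hprod.mul hlim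
  rw [mul_one, ← funext iter] at hlim2
  rw [← tendsto_nhds_unique tendsto_const_nhds hlim2]
  exact (hs x).hasSum

/-- Pairs of naturals are parametrized by their difference and their minimum. -/
def diffMinEquiv : ℤ × ℕ ≃ ℕ × ℕ where
  toFun c := (c.2 + c.1.toNat, c.2 + (-c.1).toNat)
  invFun c := ((c.1 : ℤ) - c.2, min c.1 c.2)
  left_inv c := by ext <;> simp; omega
  right_inv c := by ext <;> (simp; omega)

theorem hasSum_qPochhammerInf_mul {p : ℂ} (hp : ‖p‖ < 1) {z : ℂ} (hz : z ≠ 0) (x : ℂ) :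
    HasSum (fun c : ℤ × ℕ => z ^ c.1 * (x ^ (2 * c.2 + c.1.natAbs) *
      (eulerCoeff p c.2 * eulerCoeff p (c.2 + c.1.natAbs))))
      (qPochhammerInf (z * x) p * qPochhammerInf (z⁻¹ * x) p) := by
  have hs := summable_mul_of_summable_norm (summable_norm_eulerCoeff_mul_pow hp (z * x))
    (summable_norm_eulerCoeff_mul_pow hp (z⁻¹ * x))
  have h := (hasSum_eulerCoeff hp (z * x)).mul (hasSum_eulerCoeff hp (z⁻¹ * x)) hs
  refine (diffMinEquiv.hasSum_iff.mpr h).congr_fun fun c => ?_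
  obtain ⟨j, k⟩ := c
  obtain ⟨J, rfl | rfl⟩ := j.eq_nat_or_neg
  · simp only [diffMinEquiv, Equiv.coe_fn_mk, Function.comp_apply, Int.natAbs_natCast,
      Int.toNat_natCast, Int.toNat_neg_natCast, zpow_natCast, add_zero]
    have : z ^ k * z⁻¹ ^ k = 1 := by rw [← mul_pow, mul_inv_cancel₀ hz, one_pow]
    simp only [mul_pow, pow_add, two_mul]
    linear_combination (-(x ^ k * x ^ k * x ^ J * z ^ J *
      eulerCoeff p k * eulerCoeff p (k + J))) * this
  · simp only [diffMinEquiv, Equiv.coe_fn_mk, Function.comp_apply, Int.natAbs_natCast, neg_neg,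
      Int.natAbs_neg, Int.toNat_natCast, Int.toNat_neg_natCast, zpow_neg, zpow_natCast, add_zero]
    have : z ^ k * z⁻¹ ^ k = 1 := by rw [← mul_pow, mul_inv_cancel₀ hz, one_pow]
    simp only [mul_pow, pow_add, two_mul, ← inv_pow]
    linear_combination (-(x ^ k * x ^ k * x ^ J * z⁻¹ ^ J *
      eulerCoeff p k * eulerCoeff p (k + J))) * this

/-- Euler's expansion of `(p^{k+J+1}; p)_∞ = (p; p)_∞ / (p; p)_{k+J}`, `p = q ^ 2`, read backwards.
-/
theorem hasSum_expansionTerm {q : ℂ} (hq : ‖q‖ < 1) (J n k : ℕ) :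
    HasSum (fun l => expansionTerm q J n k l)
      ((-1) ^ n * qPochhammer q (q ^ 2) n * q ^ n ^ 2 * qPochhammerInf (q ^ 2) (q ^ 2) *
        ((q ^ 2 * (q ^ 2) ^ n) ^ (2 * k + J) *
          (eulerCoeff (q ^ 2) k * eulerCoeff (q ^ 2) (k + J)))) := by
  have hp := norm_sq_lt_one hq
  have h := (hasSum_eulerCoeff hp (q ^ 2 * (q ^ 2) ^ (k + J))).mul_left
    ((-1) ^ n * qPochhammer q (q ^ 2) n * q ^ n ^ 2 * (q ^ 2) ^ ((n + 1) * (2 * k + J)) *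
    eulerCoeff (q ^ 2) k * ((-1) ^ (k + J) * (q ^ 2) ^ (k + J).choose 2))
  have hP := qPochhammer_self_ne_zero hp (k + J)
  convert! h using 1
  · funext l
    rw [expansionTerm, ← pow_succ', pow_mul _ (k + J + 1) l]
  · rw [qPochhammerInf_eq_mul hp _ (k + J)]
    simp only [eulerCoeff, ← pow_succ', ← pow_mul (q ^ 2)]
    field_simp

theorem qPochhammerInf_mul_mockKTerm {q z : ℂ} (hq : ‖q‖ < 1)
    (hpole : ∀ k : ℕ, 1 ≤ k → z * q ^ (2 * k) ≠ 1)
    (hpole_inv : ∀ k : ℕ, 1 ≤ k → z⁻¹ * q ^ (2 * k) ≠ 1) (n : ℕ) :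
    qPochhammerInf (z * q ^ 2) (q ^ 2) * qPochhammerInf (z⁻¹ * q ^ 2) (q ^ 2) *
      qPochhammerInf (q ^ 2) (q ^ 2) * mockKTerm z q n =
    (-1) ^ n * qPochhammer q (q ^ 2) n * q ^ n ^ 2 * qPochhammerInf (q ^ 2) (q ^ 2) *
      (qPochhammerInf (z * (q ^ 2 * (q ^ 2) ^ n)) (q ^ 2) *
        qPochhammerInf (z⁻¹ * (q ^ 2 * (q ^ 2) ^ n)) (q ^ 2)) := by
  have hp := norm_sq_lt_one hq
  have ne : ∀ w : ℂ, (∀ k : ℕ, 1 ≤ k → w * q ^ (2 * k) ≠ 1) →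
      qPochhammer (w * q ^ 2) (q ^ 2) n ≠ 0 := by
    intro w hw
    refine Finset.prod_ne_zero_iff.mpr fun i _ h => hw (i + 1) (by omega) ?_
    linear_combination -h
  have h1 := ne z hpole
  have h2 := ne z⁻¹ hpole_inv
  rw [qPochhammerInf_eq_mul hp (z * q ^ 2) n, qPochhammerInf_eq_mul hp (z⁻¹ * q ^ 2) n, mockKTerm,
    mul_assoc z, mul_assoc z⁻¹]
  rw [mul_div_assoc', div_eq_iff (mul_ne_zero h1 h2)]
  ring

/-! ### Absolute convergence of the multiple series. -/

theorem summable_mockKTerm {q z : ℂ} (hq : ‖q‖ < 1) : Summable (mockKTerm z q) := by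
  have hp := norm_sq_lt_one hq
  refine (summable_norm_of_ratio (r := fun n => -(1 - q * (q ^ 2) ^ n) * (q * (q ^ 2) ^ n) /
    ((1 - z * q ^ 2 * (q ^ 2) ^ n) * (1 - z⁻¹ * q ^ 2 * (q ^ 2) ^ n))) (fun n => ?_) ?_).of_norm
  · simp only [mockKTerm, qPochhammer_succ]
    rw [div_mul_div_comm]
    congr 1 <;> ring
  · have h := fun a : ℂ => (tendsto_pow_atTop_nhds_zero_of_norm_lt_one hp).const_mul a
    simp only [mul_zero] at h
    have h1 := fun a => (h a).const_sub 1
    simpa [Pi.div_def] using ((h1 q).neg.mul (h q)).div ((h1 (z * q ^ 2)).mul (h1 (z⁻¹ * q ^ 2))) (by simp)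

theorem summable_norm_pow_choose_two {q : ℂ} (hq : ‖q‖ < 1) (x : ℂ) :
    Summable fun n : ℕ => ‖x ^ n * q ^ n.choose 2‖ := by
  refine summable_norm_of_ratio (r := fun n => x * q ^ n) (fun n => ?_) ?_
  · rw [choose_succ_two]; ring
  · simpa using (tendsto_pow_atTop_nhds_zero_of_norm_lt_one hq).const_mul x

theorem summable_norm_zpow_choose_two {q : ℂ} (hq : ‖q‖ < 1) (z : ℂ) :
    Summable fun j : ℤ => ‖z ^ j * q ^ j.natAbs.choose 2‖ := by
  refine .of_nat_of_neg ?_ ?_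
  · simpa using summable_norm_pow_choose_two hq z
  · simpa using summable_norm_pow_choose_two hq z⁻¹

theorem summable_norm_qPochhammer_mul_pow_sq {q : ℂ} (hq : ‖q‖ < 1) :
    Summable fun n : ℕ => ‖qPochhammer q (q ^ 2) n * q ^ n ^ 2‖ := by
  refine summable_norm_of_ratio (r := fun n => (1 - q * (q ^ 2) ^ n) * (q * (q ^ 2) ^ n))
    (fun n => ?_) ?_
  · rw [qPochhammer_succ]; ring
  · have h := (tendsto_pow_atTop_nhds_zero_of_norm_lt_one (norm_sq_lt_one hq)).const_mul q
    simpa using (h.const_sub 1).mul h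

/-- The bound separates the indices; the factor in `J.choose 2` is kept because it must dominate `z
^ j` in both directions. -/
theorem norm_expansionTerm_le {q : ℂ} (hq : ‖q‖ < 1) (J n k l : ℕ) :
    ‖expansionTerm q J n k l‖ ≤ ‖qPochhammer q (q ^ 2) n * q ^ n ^ 2‖ *
      (‖(q ^ 2) ^ J.choose 2‖ * ‖eulerCoeff (q ^ 2) k‖ * ‖eulerCoeff (q ^ 2) l‖) := by
  have h1 : ∀ m, ‖(q ^ 2) ^ m‖ ≤ 1 := fun m => by
    rw [norm_pow]; exact pow_le_one₀ (norm_nonneg _) (norm_sq_lt_one hq).le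
  have h2 : ‖(q ^ 2) ^ ((n + 1) * (2 * k + J) + (k.choose 2 + k * J) + (k + J + 1) * l)‖ ≤ 1 :=
    h1 _
  calc ‖expansionTerm q J n k l‖
      = ‖qPochhammer q (q ^ 2) n * q ^ n ^ 2‖ *
        (‖(q ^ 2) ^ J.choose 2‖ * ‖eulerCoeff (q ^ 2) k‖ * ‖eulerCoeff (q ^ 2) l‖) *
        ‖(q ^ 2) ^ ((n + 1) * (2 * k + J) + (k.choose 2 + k * J) + (k + J + 1) * l)‖ := by
        rw [expansionTerm, add_choose_two]
        simp only [norm_mul, norm_pow, norm_neg, norm_one, one_pow, pow_add]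
        ring
    _ ≤ _ := mul_le_of_le_one_right (by positivity) h2

theorem summable_expansion {q : ℂ} (hq : ‖q‖ < 1) (z : ℂ) :
    Summable fun c : ℕ × (ℤ × ℕ) × ℕ =>
      z ^ c.2.1.1 * expansionTerm q c.2.1.1.natAbs c.1 c.2.1.2 c.2.2 := by
  have hp := norm_sq_lt_one hq
  have hE : Summable fun k => ‖eulerCoeff (q ^ 2) k‖ := by
    simpa using summable_norm_eulerCoeff_mul_pow hp 1
  have hb := (summable_norm_qPochhammer_mul_pow_sq hq).mul_of_nonneg
    (((summable_norm_zpow_choose_two hp z).mul_of_nonneg hE (fun _ => norm_nonneg _)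
      (fun _ => norm_nonneg _)).mul_of_nonneg hE (fun _ => by positivity) (fun _ => norm_nonneg _))
    (fun _ => norm_nonneg _) (fun _ => by positivity)
  refine hb.of_norm_bounded fun c => ?_
  rw [norm_mul]
  refine (mul_le_mul_of_nonneg_left (norm_expansionTerm_le hq _ _ _ _) (norm_nonneg _)).trans ?_
  rw [norm_mul (z ^ c.2.1.1)]
  exact le_of_eq (by ring)

theorem hasSum_expansion {q z : ℂ} (hq : ‖q‖ < 1) (hz : z ≠ 0)
    (hpole : ∀ k : ℕ, 1 ≤ k → z * q ^ (2 * k) ≠ 1)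
    (hpole_inv : ∀ k : ℕ, 1 ≤ k → z⁻¹ * q ^ (2 * k) ≠ 1) :
    HasSum (fun c : ℕ × (ℤ × ℕ) × ℕ =>
      z ^ c.2.1.1 * expansionTerm q c.2.1.1.natAbs c.1 c.2.1.2 c.2.2)
      (qPochhammerInf (z * q ^ 2) (q ^ 2) * qPochhammerInf (z⁻¹ * q ^ 2) (q ^ 2) *
        qPochhammerInf (q ^ 2) (q ^ 2) * mockK z q) := by
  have hs := summable_expansion hq z
  have inner : ∀ n, HasSum (fun c : (ℤ × ℕ) × ℕ =>
      z ^ c.1.1 * expansionTerm q c.1.1.natAbs n c.1.2 c.2)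
      (qPochhammerInf (z * q ^ 2) (q ^ 2) * qPochhammerInf (z⁻¹ * q ^ 2) (q ^ 2) *
        qPochhammerInf (q ^ 2) (q ^ 2) * mockKTerm z q n) := by
    intro n
    have h1 : HasSum (fun c : (ℤ × ℕ) × ℕ =>
      z ^ c.1.1 * expansionTerm q c.1.1.natAbs n c.1.2 c.2) _ := (hs.prod_factor n).hasSum
    have h2 := h1.prod_fiberwise fun c : ℤ × ℕ =>
      (hasSum_expansionTerm hq c.1.natAbs n c.2).mul_left (z ^ c.1)
    have h3 := (hasSum_qPochhammerInf_mul (norm_sq_lt_one hq) hz (q ^ 2 * (q ^ 2) ^ n)).mul_left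
      ((-1) ^ n * qPochhammer q (q ^ 2) n * q ^ n ^ 2 * qPochhammerInf (q ^ 2) (q ^ 2))
    rw [← qPochhammerInf_mul_mockKTerm hq hpole hpole_inv] at h3
    -- Both `h2` and `h3` sum the same series over `(j, k)`, so their values agree.
    rw [← h2.unique (h3.congr_fun fun c => by ring)]
    exact h1
  have h4 := hs.hasSum.prod_fiberwise inner
  have h5 := (summable_mockKTerm (z := z) hq).hasSum.mul_left (qPochhammerInf (z * q ^ 2) (q ^ 2) *
    qPochhammerInf (z⁻¹ * q ^ 2) (q ^ 2) * qPochhammerInf (q ^ 2) (q ^ 2))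
  rw [mockK, ← h4.unique h5]
  exact hs.hasSum

/-! ### Regrouping into the Hecke-Rogers sum. -/

theorem HasSum.finset_fiberwise {β γ : Type*} {f : β → ℂ} {a : ℂ} (hf : HasSum f a) (g : β → γ)
    (s : γ → Finset β) (hs : ∀ c b, b ∈ s c ↔ g b = c) :
    HasSum (fun c => ∑ b ∈ s c, f b) a := by
  refine (hf.tsum_fiberwise g).congr_fun fun c => ?_
  have : g ⁻¹' {c} = (s c : Set β) := by ext b; simp [hs]
  rw [this, Finset.tsum_subtype']

theorem HasSum.sum_antidiagonal {γ : Type*} {f : γ × ℕ × ℕ → ℂ} {a : ℂ} (hf : HasSum f a) :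
    HasSum (fun c : γ × ℕ => ∑ d ∈ Finset.HasAntidiagonal.antidiagonal c.2, f (c.1, d)) a := by
  refine (hf.finset_fiberwise (fun b => (b.1, b.2.1 + b.2.2)) (fun c =>
    (Finset.HasAntidiagonal.antidiagonal c.2).map (Function.Embedding.sectR c.1 _))
    fun c b => ?_).congr_fun fun c => ?_
  · obtain ⟨c, s⟩ := c
    obtain ⟨b, k, l⟩ := b
    simp [Finset.mem_map]
    grind
  · simp

theorem hasSum_partialTheta {q z : ℂ} (hq : ‖q‖ < 1) {a : ℂ}
    (h : HasSum (fun c : ℕ × (ℤ × ℕ) × ℕ =>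
      z ^ c.2.1.1 * expansionTerm q c.2.1.1.natAbs c.1 c.2.1.2 c.2.2) a) :
    HasSum (fun c : ℤ × ℕ => z ^ c.1 * ((-1) ^ (c.1.natAbs + c.2) *
      q ^ (c.1.natAbs ^ 2 + c.1.natAbs + 2 * c.1.natAbs * c.2 + (c.2 + 1).choose 2))) a := by
  let e : (ℤ × ℕ) × ℕ × ℕ ≃ ℕ × (ℤ × ℕ) × ℕ :=
    { toFun := fun c => (c.1.2, (c.1.1, c.2.1), c.2.2)
      invFun := fun c => ((c.2.1.1, c.1), (c.2.1.2, c.2.2))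
      left_inv := fun _ => rfl
      right_inv := fun _ => rfl }
  have h1 := ((e.hasSum_iff).mpr h).sum_antidiagonal
  have h2 := (((Equiv.prodAssoc ℤ ℕ ℕ).symm.hasSum_iff).mpr h1).sum_antidiagonal
  refine h2.congr_fun fun c => ?_
  rw [← sum_expansionTerm hq, Finset.mul_sum]
  refine Finset.sum_congr rfl fun d _ => ?_
  simp [e, Finset.mul_sum]

theorem heckeRogersTerm_eq_sum (z q : ℂ) (N : ℕ) :
    heckeRogersTerm z q N = ∑ j ∈ Finset.Icc (-(N : ℤ)) N, z ^ j * ((-1) ^ N *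
      q ^ (j.natAbs ^ 2 + j.natAbs + 2 * j.natAbs * (N - j.natAbs) +
        (N - j.natAbs + 1).choose 2)) := by
  have hch : ∀ M : ℕ, (((M + 1).choose 2 : ℕ) : ℤ) * 2 = M * (M + 1) := by
    intro M
    have := Nat.div_mul_cancel (Nat.even_mul_pred_self (M + 1)).two_dvd
    rw [← Nat.choose_two_right, Nat.add_sub_cancel] at this
    rw [mul_comm (M : ℤ)]
    exact_mod_cast this
  -- The first inner sum supplies the exponents `j ≤ 0` of `z`, the second those with `j ≥ 1`.
  have hsplit : Finset.Icc (-(N : ℤ)) N =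
      (Finset.Icc 0 N).image (fun m : ℕ => (m : ℤ) - N) ∪
      (Finset.Icc 1 N).image (fun m : ℕ => (N : ℤ) - m + 1) := by
    ext j
    simp only [Finset.mem_Icc, Finset.mem_union, Finset.mem_image]
    constructor
    · intro h
      rcases le_or_gt j 0 with hj | hj
      · exact Or.inl ⟨(j + N).toNat, by omega, by omega⟩
      · exact Or.inr ⟨(N + 1 - j).toNat, by omega, by omega⟩
    · rintro (⟨m, hm, rfl⟩ | ⟨m, hm, rfl⟩) <;> omega
  rw [hsplit, Finset.sum_union, Finset.sum_image, Finset.sum_image, heckeRogersTerm]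
  · congr 1 <;> refine Finset.sum_congr rfl fun m hm => ?_
    · obtain ⟨J, rfl⟩ := Nat.exists_eq_add_of_le (Finset.mem_Icc.mp hm).2
      have e1 : ((m : ℤ) - ((m + J : ℕ) : ℤ)).natAbs = J := by omega
      rw [e1, Nat.add_sub_cancel, ← zpow_natCast q]
      have := hch m
      have e2 : ((2 * ((m + J : ℕ) : ℤ) ^ 2 - (m : ℤ) ^ 2) + (2 * ((m + J : ℕ) : ℤ) - (m : ℤ))) / 2
          = ((J ^ 2 + J + 2 * J * m + (m + 1).choose 2 : ℕ) : ℤ) := by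
        refine Int.ediv_eq_of_eq_mul_left two_ne_zero ?_
        push_cast
        linear_combination -this
      rw [e2]
      ring
    -- Here `|j| = N - m + 1`, so `N - |j|` is `m - 1`.
    · obtain ⟨M, rfl⟩ := Nat.exists_eq_add_of_le' (Finset.mem_Icc.mp hm).1
      obtain ⟨J, rfl⟩ := Nat.exists_eq_add_of_le (Finset.mem_Icc.mp hm).2
      have e1 : (((M + 1 + J : ℕ) : ℤ) - ((M + 1 : ℕ) : ℤ) + 1).natAbs = J + 1 := by omega
      rw [e1, show M + 1 + J - (J + 1) = M by omega, ← zpow_natCast q]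
      have := hch M
      have e2 : ((2 * ((M + 1 + J : ℕ) : ℤ) ^ 2 - ((M + 1 : ℕ) : ℤ) ^ 2) +
          (2 * ((M + 1 + J : ℕ) : ℤ) + ((M + 1 : ℕ) : ℤ))) / 2
          = (((J + 1) ^ 2 + (J + 1) + 2 * (J + 1) * M + (M + 1).choose 2 : ℕ) : ℤ) := by
        refine Int.ediv_eq_of_eq_mul_left two_ne_zero ?_
        push_cast
        linear_combination -this
      rw [e2]
      ring
  · intro a _ b _ h; simpa using h
  · intro a _ b _ h; simpa using h
  · rw [Finset.disjoint_left]
    intro j h1 h2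
    simp only [Finset.mem_image, Finset.mem_Icc] at h1 h2
    omega

theorem hasSum_heckeRogersTerm {q z a : ℂ}
    (h : HasSum (fun c : ℤ × ℕ => z ^ c.1 * ((-1) ^ (c.1.natAbs + c.2) *
      q ^ (c.1.natAbs ^ 2 + c.1.natAbs + 2 * c.1.natAbs * c.2 + (c.2 + 1).choose 2))) a) :
    HasSum (heckeRogersTerm z q) a := by
  refine (h.finset_fiberwise (fun c => c.1.natAbs + c.2) (fun N =>
    (Finset.Icc (-(N : ℤ)) N).image fun j => (j, N - j.natAbs)) fun N c => ?_).congr_fun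
    fun N => ?_
  · obtain ⟨j, M⟩ := c
    simp only [Finset.mem_image, Finset.mem_Icc, Prod.mk.injEq]
    constructor
    · rintro ⟨i, hi, rfl, rfl⟩; omega
    · intro hN; exact ⟨j, by omega, rfl, by omega⟩
  · rw [heckeRogersTerm_eq_sum, Finset.sum_image fun i _ j _ hij => (Prod.mk.inj hij).1]
    refine Finset.sum_congr rfl fun j hj => ?_
    rw [Finset.mem_Icc] at hj
    rw [Nat.add_sub_cancel' (show j.natAbs ≤ N by omega)]

theorem mainTheorem3 (q z : ℂ) (hq : ‖q‖ < 1) (hz : z ≠ 0)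
    (hpole : ∀ k : ℕ, 1 ≤ k → z * q ^ (2 * k) ≠ 1)
    (hpole_inv : ∀ k : ℕ, 1 ≤ k → z⁻¹ * q ^ (2 * k) ≠ 1) :
    (∀ a : ℂ, Multipliable (fun i : ℕ => 1 - a * (q ^ 2) ^ i)) ∧
    Summable (mockKTerm z q) ∧
    HasSum (heckeRogersTerm z q)
      (qPochhammerInf (z * q ^ 2) (q ^ 2) * qPochhammerInf (z⁻¹ * q ^ 2) (q ^ 2) *
        qPochhammerInf (q ^ 2) (q ^ 2) * mockK z q) :=
  ⟨multipliable_one_sub_mul_pow (norm_sq_lt_one hq), summable_mockKTerm hq,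
    hasSum_heckeRogersTerm (hasSum_partialTheta hq (hasSum_expansion hq hz hpole hpole_inv))⟩
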